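/- Let $(K,\le)$ be an arbitrary partially ordered set and let $N=\{n_{ba} : a,b\in K,\ a\le b\}$ be positive integers satisfying the factorization equalities $n_{ca}=n_{cb}\,n_{ba}$ whenever $a\le b\le c$. For a subgroup $\Gamma\subset\mathbb{Q}$ put $\Gamma^+=\Gamma\cap[0,\infty)$ and let $C^*_r(\Gamma^+)$ be the $C^*$-subalgebra of $B(\ell^2(\Gamma^+))$ generated by the isometries $V_g$, $V_ge_h=e_{g+h}$ $(g,h\in\Gamma^+)$, where $\{e_h\}$ is the canonical orthonormal basis. The Toeplitz algebra is $\mathcal{T}=C^*_r(\mathbb{Z}^+)$, with generator $T=V_1$; for every $n\ge 1$ there is a unique unital $*$-homomorphism $\mathcal{T}\to\mathcal{T}$ with $T\mapsto T^n$, and it is injective. For a sequence $M=(m_1,m_2,\dots)$ of positive integers put $$\mathbb{Q}_M=\Bigl\{\tfrac{m}{m_1m_2\cdots m_s} : m\in\mathbb{Z},\ s\ge 1\Bigr\}.$$ Let $\mathcal{F}=(K,\{\mathcal{T}_a\},\{\sigma_{ba}\})$ be the inductive system of Toeplitz algebras over $K$ defined by $N$: $\mathcal{T}_a=\mathcal{T}$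 for all $a\in K$, and $\sigma_{ba}:\mathcal{T}_a\to\mathcal{T}_b$, $T\mapsto T^{n_{ba}}$, for $a\le b$. Let $\{K_i\}_{i\in I}$ be the family of all maximal (non-empty, upward) directed subsets of $K$, and for $i\in I$ let $\mathcal{F}_i$ be the subsystem of $\mathcal{F}$ over $K_i$ and $\varinjlim\mathcal{F}_i$ its inductive limit in the category of unital $C^*$-algebras. Then $K=\bigcup_{i\in I}K_i$, and there exists a family $\{M_i\}_{i\in I}$ of sequences of positive integers such that the direct products of $C^*$-algebras (bounded families, pointwise operations, supremum norm) are isomorphic as unital $C^*$-algebras: $$\prod_{i\in I}\varinjlim\mathcal{F}_i\;\simeq\;\prod_{i\in I}C^*_r(\mathbb{Q}_{M_i}^+).$$ -/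

import Mathlib

open scoped ENNReal

universe u v w

/-- An inductive system of unital C⋆-algebras over a partially ordered set `K`: a functor from `K`
to unital C⋆-algebras whose connecting morphisms are unital injective ⋆-homomorphisms. -/
structure CStarSystem (K : Type u) [PartialOrder K] where
  /-- the algebra at `a` -/
  obj : K → Type v
  [inst : ∀ a, CStarAlgebra (obj a)]
  /-- the connecting morphism from the algebra at `a` to the algebra at `b` -/
  map : ∀ a b, a ≤ b → (obj a →⋆ₐ[ℂ] obj b)
  map_injective : ∀ a b (h : a ≤ b), Function.Injective (map a b h)
  map_self : ∀ a x, map a a le_rfl x = x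
  map_map : ∀ a b c (hab : a ≤ b) (hbc : b ≤ c) x,
    map b c hbc (map a b hab x) = map a c (hab.trans hbc) x

namespace CStarSystem

attribute [instance] CStarSystem.inst

/-- The inductive subsystem over a subset `S`. -/
def restrict {K : Type u} [PartialOrder K] (F : CStarSystem.{u, v} K) (S : Set K) :
    CStarSystem.{u, v} S where
  obj a := F.obj a
  map a b h := F.map a b h
  map_injective a b h := F.map_injective a b h
  map_self a := F.map_self a
  map_map a b c hab hbc := F.map_map a b c hab hbc

section limit

variable {K : Type u} [PartialOrder K] (F : CStarSystem.{u, v} K)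

instance directedSystem : DirectedSystem F.obj (F.map · · ·) where
  map_self _ x := F.map_self _ x
  map_map _ _ _ hij hjk x := F.map_map _ _ _ hij hjk x

theorem norm_map {a b : K} (h : a ≤ b) (x : F.obj a) : ‖F.map a b h x‖ = ‖x‖ :=
  NonUnitalStarAlgHom.norm_map _ (F.map_injective a b h) x

variable [IsDirectedOrder K]

/-- The algebraic direct limit of a system over a directed set: pairs `(a, x)` with `x` in the
algebra at `a`, where `(a, x)` and `(b, y)` are identified when `x` and `y` have the same image in
the algebra at some `c ≥ a, b`. -/
abbrev AlgLimit : Type (max u v) := DirectLimit F.obj F.map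

/-- The norm on the algebraic direct limit: the norm of the class of `(a, x)` is `‖x‖`. -/
noncomputable def algNorm : F.AlgLimit → ℝ :=
  DirectLimit.lift F.map (fun _ x => ‖x‖) fun _ _ h x => (F.norm_map h x).symm

theorem algNorm_mk (a : K) (x : F.obj a) : F.algNorm (⟦⟨a, x⟩⟧ : F.AlgLimit) = ‖x‖ := rfl

variable [Nonempty K]

noncomputable instance algNormedRing : NormedRing F.AlgLimit where
  __ := (inferInstance : Ring F.AlgLimit)
  __ := AddGroupNorm.toNormedAddCommGroup
    { toFun := F.algNorm
      map_zero' := by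
        obtain ⟨a⟩ := ‹Nonempty K›
        rw [DirectLimit.zero_def a, algNorm_mk, norm_zero]
      add_le' := DirectLimit.induction₂ _ fun a x y => by
        rw [DirectLimit.add_def]
        exact norm_add_le x y
      neg' := DirectLimit.induction _ fun a x => by
        rw [DirectLimit.neg_def]
        exact norm_neg x
      eq_zero_of_map_eq_zero' := DirectLimit.induction _ fun a x hx => by
        rw [algNorm_mk, norm_eq_zero] at hx
        rw [DirectLimit.zero_def a, hx] }
  norm_mul_le := DirectLimit.induction₂ _ fun a x y => by
    rw [DirectLimit.mul_def]
    exact norm_mul_le x y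

theorem algLimit_norm_mk (a : K) (x : F.obj a) : ‖(⟦⟨a, x⟩⟧ : F.AlgLimit)‖ = ‖x‖ := rfl

noncomputable instance algStarRing : StarRing F.AlgLimit where
  star_add := star_add

noncomputable instance algNormedAlgebra : NormedAlgebra ℂ F.AlgLimit where
  __ := (inferInstance : Algebra ℂ F.AlgLimit)
  norm_smul_le r := DirectLimit.induction _ fun a x => by
    rw [DirectLimit.smul_def]
    exact norm_smul_le r x

instance algCStarRing : CStarRing F.AlgLimit where
  norm_mul_self_le := DirectLimit.induction _ fun a x => by
    rw [DirectLimit.star_def, DirectLimit.mul_def]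
    exact CStarRing.norm_mul_self_le x

/-- The inductive limit of a system of C⋆-algebras over a directed set: the completion of the
algebraic direct limit. -/
def Limit : Type (max u v) := UniformSpace.Completion F.AlgLimit

namespace Limit

open UniformSpace

noncomputable instance : NormedRing F.Limit :=
  inferInstanceAs (NormedRing (Completion F.AlgLimit))

noncomputable instance : NormedAlgebra ℂ F.Limit where
  __ := (inferInstance : Algebra ℂ (Completion F.AlgLimit))
  norm_smul_le r x := norm_smul_le r (show Completion F.AlgLimit from x)

instance : CompleteSpace F.Limit :=
  inferInstanceAs (CompleteSpace (Completion F.AlgLimit))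

/-- The canonical map of the algebraic direct limit into the limit. -/
noncomputable def coe (x : F.AlgLimit) : F.Limit := (x : Completion F.AlgLimit)

noncomputable instance : Star F.Limit :=
  ⟨Completion.map (star : F.AlgLimit → F.AlgLimit)⟩

theorem denseRange_coe : DenseRange (coe F) := Completion.denseRange_coe
theorem norm_coe (x : F.AlgLimit) : ‖coe F x‖ = ‖x‖ := Completion.norm_coe x
theorem coe_add (x y : F.AlgLimit) : coe F (x + y) = coe F x + coe F y := Completion.coe_add x y
theorem coe_mul (x y : F.AlgLimit) : coe F (x * y) = coe F x * coe F y := Completion.coe_mul x y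
theorem coe_smul (r : ℂ) (x : F.AlgLimit) : coe F (r • x) = r • coe F x := Completion.coe_smul r x
theorem coe_one : coe F 1 = 1 := Completion.coe_one _
theorem coe_zero : coe F 0 = 0 := Completion.coe_zero

theorem star_coe (x : F.AlgLimit) : star (coe F x) = coe F (star x) :=
  Completion.map_coe (starₗᵢ ℂ (E := F.AlgLimit)).isometry.uniformContinuous x

theorem continuous_star' : Continuous (star : F.Limit → F.Limit) := Completion.continuous_map

noncomputable instance : CStarAlgebra F.Limit where
  star_involutive x := by
    refine (denseRange_coe F).induction_on (p := fun x => star (star x) = x) x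
      (isClosed_eq ((continuous_star' F).comp (continuous_star' F)) continuous_id) fun x => ?_
    rw [star_coe, star_coe, star_star]
  star_mul x y := by
    refine (denseRange_coe F).induction_on₂ (p := fun x y => star (x * y) = star y * star x)
      (isClosed_eq ((continuous_star' F).comp continuous_mul)
        (((continuous_star' F).comp continuous_snd).mul
          ((continuous_star' F).comp continuous_fst))) (fun x y => ?_) x y
    rw [← coe_mul, star_coe, star_coe, star_coe, ← coe_mul, star_mul]
  star_add x y := by
    refine (denseRange_coe F).induction_on₂ (p := fun x y => star (x + y) = star x + star y)
      (isClosed_eq ((continuous_star' F).comp continuous_add)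
        (((continuous_star' F).comp continuous_fst).add
          ((continuous_star' F).comp continuous_snd))) (fun x y => ?_) x y
    rw [← coe_add, star_coe, star_coe, star_coe, ← coe_add, star_add]
  norm_mul_self_le x := by
    refine (denseRange_coe F).induction_on (p := fun x => ‖x‖ * ‖x‖ ≤ ‖star x * x‖) x
      (isClosed_le (continuous_norm.mul continuous_norm)
        (((continuous_star' F).mul continuous_id).norm)) fun x => ?_
    rw [star_coe, ← coe_mul, norm_coe, norm_coe]
    exact CStarRing.norm_mul_self_le x
  star_smul r x := by
    refine (denseRange_coe F).induction_on (p := fun x => star (r • x) = star r • star x) x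
      (isClosed_eq ((continuous_star' F).comp (continuous_const_smul r))
        ((continuous_const_smul (star r)).comp (continuous_star' F))) fun x => ?_
    rw [← coe_smul, star_coe, star_coe, ← coe_smul, star_smul]

/-- The canonical morphism from the algebra at `a` to the inductive limit. -/
noncomputable def of (a : K) : F.obj a →⋆ₐ[ℂ] F.Limit where
  toFun x := coe F ⟦⟨a, x⟩⟧
  map_one' := by rw [← DirectLimit.one_def, coe_one]
  map_mul' x y := by rw [← DirectLimit.mul_def, coe_mul]
  map_zero' := by rw [← DirectLimit.zero_def, coe_zero]
  map_add' x y := by rw [← DirectLimit.add_def, coe_add]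
  commutes' r := by
    rw [Algebra.algebraMap_eq_smul_one, Algebra.algebraMap_eq_smul_one, ← DirectLimit.smul_def,
      coe_smul, ← DirectLimit.one_def, coe_one]
  map_star' x := by rw [star_coe, DirectLimit.star_def]

theorem norm_of (a : K) (x : F.obj a) : ‖of F a x‖ = ‖x‖ := norm_coe F _

theorem of_injective (a : K) : Function.Injective (of F a) :=
  (AddMonoidHomClass.isometry_of_norm (of F a) (norm_of F a)).injective

theorem of_map {a b : K} (h : a ≤ b) (x : F.obj a) : of F b (F.map a b h x) = of F a x :=
  congrArg (coe F) (DirectLimit.mk_apply a b x h)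

theorem closure_iUnion_range_of : closure (⋃ a, Set.range (of F a)) = Set.univ := by
  refine Set.eq_univ_of_univ_subset ((denseRange_coe F).closure_range.symm.subset.trans
    (closure_mono ?_))
  rintro _ ⟨x, rfl⟩
  induction x using DirectLimit.induction with
  | _ a x => exact Set.mem_iUnion.2 ⟨a, x, rfl⟩

end Limit

end limit

end CStarSystem

section Toeplitz

/-- The Hilbert space `ℓ²(P)` of square summable complex functions on `P`. -/
abbrev EllTwo (P : Type u) : Type u := lp (fun _ : P => ℂ) 2

namespace EllTwo

open scoped Classical in
/-- The canonical orthonormal basis of `ℓ²(P)`. -/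
noncomputable def e {P : Type u} (h : P) : EllTwo P := lp.single 2 h (1 : ℂ)

theorem inner_e_left {P : Type u} (h : P) (f : EllTwo P) : inner ℂ (e h) f = f h := by
  classical
  rw [e, lp.inner_single_left]
  simp

open scoped Classical in
theorem e_apply {P : Type u} (g h : P) : (e g : EllTwo P) h = if g = h then 1 else 0 := by
  rw [e, lp.coeFn_single, Pi.single_apply]
  simp only [eq_comm]

theorem inner_e_e {P : Type u} [DecidableEq P] (g h : P) :
    inner ℂ (e g) (e h) = if g = h then (1 : ℂ) else 0 := by
  rw [inner_e_left, e_apply]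
  by_cases hgh : g = h
  · rw [if_pos hgh, if_pos hgh.symm]
  · rw [if_neg hgh, if_neg (Ne.symm hgh)]

theorem orthonormal_e (P : Type u) : Orthonormal ℂ (e : P → EllTwo P) := by
  classical
  exact orthonormal_iff_ite.2 inner_e_e

theorem ext_e {P : Type u} {f g : EllTwo P} (h : ∀ p, inner ℂ (e p) f = inner ℂ (e p) g) :
    f = g := by
  ext p
  rw [← inner_e_left, ← inner_e_left, h]

theorem clm_ext {P : Type u} {H : Type v} [NormedAddCommGroup H] [InnerProductSpace ℂ H]
    {A B : EllTwo P →L[ℂ] H} (h : ∀ p, A (e p) = B (e p)) : A = B := by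
  classical
  refine lp.ext_continuousLinearMap (by simp) fun p => ?_
  ext
  simpa [e] using h p

/-- The isometry `ℓ²(P) → ℓ²(Q)` that sends the basis vector `e p` to `e (s p)`, for an injective
map `s : P → Q`. -/
noncomputable def basisMap {P : Type u} {Q : Type v} (s : P → Q) (hs : Function.Injective s) :
    EllTwo P →L[ℂ] EllTwo Q :=
  ((orthonormal_e Q).comp s hs).orthogonalFamily.linearIsometry.toContinuousLinearMap

theorem basisMap_e {P : Type u} {Q : Type v} (s : P → Q) (hs : Function.Injective s) (p : P) :
    basisMap s hs (e p) = e (s p) := by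
  classical
  rw [basisMap, e, LinearIsometry.coe_toContinuousLinearMap,
    OrthogonalFamily.linearIsometry_apply_single]
  simp

end EllTwo

open EllTwo

/-- The isometry `V g` of `ℓ²(P)`, `V g (e h) = e (g + h)`. -/
noncomputable def shift {P : Type u} [AddMonoid P] [IsLeftCancelAdd P] (g : P) :
    EllTwo P →L[ℂ] EllTwo P :=
  basisMap (fun h => g + h) (add_right_injective g)

/-- The reduced semigroup C⋆-algebra of `P` as a ⋆-subalgebra: the C⋆-subalgebra of the bounded
operators on `ℓ²(P)` generated by the isometries `V g`. -/
noncomputable def reducedSubalgebra (P : Type u) [AddMonoid P] [IsLeftCancelAdd P] :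
    StarSubalgebra ℂ (EllTwo P →L[ℂ] EllTwo P) :=
  (StarAlgebra.adjoin ℂ (Set.range (shift : P → EllTwo P →L[ℂ] EllTwo P))).topologicalClosure

theorem shift_mem {P : Type u} [AddMonoid P] [IsLeftCancelAdd P] (g : P) :
    shift g ∈ reducedSubalgebra P :=
  StarSubalgebra.le_topologicalClosure _ (StarAlgebra.subset_adjoin ℂ _ ⟨g, rfl⟩)

/-- The reduced semigroup C⋆-algebra `C⋆ᵣ(P)`. -/
def ReducedAlg (P : Type u) [AddMonoid P] [IsLeftCancelAdd P] : Type u := reducedSubalgebra P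

namespace ReducedAlg

noncomputable instance cstarAlgebra (P : Type u) [AddMonoid P] [IsLeftCancelAdd P] :
    CStarAlgebra (ReducedAlg P) :=
  StarSubalgebra.cstarAlgebra (reducedSubalgebra P)
    (h_closed := StarSubalgebra.isClosed_topologicalClosure _)

/-- The inclusion of `C⋆ᵣ(P)` into the bounded operators on `ℓ²(P)`. -/
noncomputable def val (P : Type u) [AddMonoid P] [IsLeftCancelAdd P] :
    ReducedAlg P →⋆ₐ[ℂ] (EllTwo P →L[ℂ] EllTwo P) where
  toFun A := (show reducedSubalgebra P from A).1
  map_one' := rfl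
  map_mul' _ _ := rfl
  map_zero' := rfl
  map_add' _ _ := rfl
  commutes' _ := rfl
  map_star' _ := rfl

theorem val_injective (P : Type u) [AddMonoid P] [IsLeftCancelAdd P] :
    Function.Injective (val P) := Subtype.val_injective

theorem val_mem {P : Type u} [AddMonoid P] [IsLeftCancelAdd P] (A : ReducedAlg P) :
    val P A ∈ reducedSubalgebra P := A.2

theorem norm_val {P : Type u} [AddMonoid P] [IsLeftCancelAdd P] (A : ReducedAlg P) :
    ‖val P A‖ = ‖A‖ := rfl

/-- The generator `V g` as an element of `C⋆ᵣ(P)`. -/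
noncomputable def V {P : Type u} [AddMonoid P] [IsLeftCancelAdd P] (g : P) : ReducedAlg P :=
  ⟨shift g, shift_mem g⟩

theorem val_V {P : Type u} [AddMonoid P] [IsLeftCancelAdd P] (g : P) :
    val P (V g) = shift g := rfl

end ReducedAlg

theorem shift_e {P : Type u} [AddMonoid P] [IsLeftCancelAdd P] (g h : P) :
    shift g (e h) = e (g + h) := basisMap_e _ _ h

theorem shift_zero {P : Type u} [AddMonoid P] [IsLeftCancelAdd P] : shift (0 : P) = 1 :=
  clm_ext fun p => by rw [shift_e, zero_add]; rfl

theorem shift_add {P : Type u} [AddMonoid P] [IsLeftCancelAdd P] (g h : P) :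
    shift (g + h) = shift g * shift h :=
  clm_ext fun p => by
    rw [shift_e, mul_apply_eq_comp, shift_e, shift_e, add_assoc]

/-- The Toeplitz algebra `C⋆ᵣ(ℤ⁺)`, where `ℤ⁺` is the additive semigroup of non-negative
integers. -/
abbrev ToeplitzAlg : Type := ReducedAlg ℕ

/-- The generator `T = V 1` of the Toeplitz algebra. -/
noncomputable def toeplitzT : ToeplitzAlg := ReducedAlg.V 1

theorem shift_eq_pow (k : ℕ) : (shift k : EllTwo ℕ →L[ℂ] EllTwo ℕ) = shift 1 ^ k := by
  induction k with
  | zero => rw [shift_zero, pow_zero]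
  | succ k ih => rw [shift_add, ih, pow_succ]

/-- The isometry `e q ↦ e (n q + r)` of `ℓ²(ℕ)`. -/
noncomputable def residue (n : ℕ+) (r : Fin n) : EllTwo ℕ →L[ℂ] EllTwo ℕ :=
  basisMap (fun q : ℕ => (n : ℕ) * q + r) fun a b h => by
    have h' : (n : ℕ) * a + r = n * b + r := h
    exact Nat.eq_of_mul_eq_mul_left n.pos (Nat.add_right_cancel h')

theorem residue_e (n : ℕ+) (r : Fin n) (q : ℕ) : residue n r (e q) = e ((n : ℕ) * q + r) :=
  basisMap_e _ _ q

theorem residue_star_e (n : ℕ+) (r s : Fin n) (q : ℕ) :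
    star (residue n r) (e ((n : ℕ) * q + s)) = if r = s then e q else 0 := by
  refine ext_e fun p => ?_
  rw [ContinuousLinearMap.star_eq_adjoint, ContinuousLinearMap.adjoint_inner_right, residue_e,
    inner_e_e]
  have key : ((n : ℕ) * p + r = n * q + s) ↔ (r = s ∧ p = q) := by
    constructor
    · intro h
      have hr := r.2
      have hs := s.2
      have h1 : ((n : ℕ) * p + r) % n = ((n : ℕ) * q + s) % n := by rw [h]
      rw [Nat.mul_add_mod, Nat.mul_add_mod, Nat.mod_eq_of_lt hr, Nat.mod_eq_of_lt hs] at h1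
      refine ⟨Fin.ext h1, ?_⟩
      rw [h1] at h
      exact Nat.eq_of_mul_eq_mul_left n.pos (Nat.add_right_cancel h)
    · rintro ⟨rfl, rfl⟩
      rfl
  by_cases hrs : r = s
  · simp [hrs, inner_e_e]
  · simp [key, hrs]

theorem residue_star_mul (n : ℕ+) (r s : Fin n) :
    star (residue n r) * residue n s = if r = s then 1 else 0 :=
  clm_ext fun q => by
    rw [mul_apply_eq_comp, residue_e, residue_star_e]
    split_ifs <;> rfl

theorem exists_residue (n : ℕ+) (p : ℕ) : ∃ (q : ℕ) (s : Fin n), p = n * q + s :=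
  ⟨p / n, ⟨p % n, Nat.mod_lt _ n.pos⟩, (Nat.div_add_mod p n).symm⟩

theorem sum_residue_mul_star (n : ℕ+) : ∑ r, residue n r * star (residue n r) = 1 :=
  clm_ext fun p => by
    obtain ⟨q, s, rfl⟩ := exists_residue n p
    simp [residue_star_e, apply_ite, residue_e]

/-- The unital ⋆-endomorphism `A ↦ ∑ r, S r A (S r)⋆` of the bounded operators on `ℓ²(ℕ)`, where
`S r (e q) = e (n q + r)` for `0 ≤ r < n`. -/
noncomputable def ampliation (n : ℕ+) :
    (EllTwo ℕ →L[ℂ] EllTwo ℕ) →⋆ₐ[ℂ] (EllTwo ℕ →L[ℂ] EllTwo ℕ) where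
  toFun A := ∑ r, residue n r * A * star (residue n r)
  map_one' := by simp only [mul_one, sum_residue_mul_star]
  map_mul' A B := by
    rw [Finset.sum_mul_sum]
    refine Finset.sum_congr rfl fun r _ => ?_
    have : ∀ s, residue n r * A * star (residue n r) * (residue n s * B * star (residue n s)) =
        residue n r * A * (star (residue n r) * residue n s) * B * star (residue n s) := by
      intro s
      simp only [mul_assoc]
    simp only [this, residue_star_mul]
    simp [mul_assoc]
  map_zero' := by simp
  map_add' A B := by simp [mul_add, add_mul, Finset.sum_add_distrib]
  commutes' c := by
    simp only [Algebra.algebraMap_eq_smul_one, mul_smul_comm, smul_mul_assoc, mul_one,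
      ← Finset.smul_sum, sum_residue_mul_star]
  map_star' A := by simp [mul_assoc, star_sum]

theorem ampliation_apply (n : ℕ+) (A : EllTwo ℕ →L[ℂ] EllTwo ℕ) :
    ampliation n A = ∑ r, residue n r * A * star (residue n r) := rfl

theorem ampliation_injective (n : ℕ+) : Function.Injective (ampliation n) := by
  intro A B h
  have key : ∀ A, star (residue n ⟨0, n.pos⟩) * ampliation n A * residue n ⟨0, n.pos⟩ = A := by
    intro A
    rw [ampliation_apply, Finset.mul_sum, Finset.sum_mul]
    have : ∀ r : Fin n, star (residue n ⟨0, n.pos⟩) * (residue n r * A * star (residue n r)) *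
        residue n ⟨0, n.pos⟩ = (star (residue n ⟨0, n.pos⟩) * residue n r) * A *
          (star (residue n r) * residue n ⟨0, n.pos⟩) := by
      intro r
      simp only [mul_assoc]
    simp only [this, residue_star_mul]
    rw [Finset.sum_eq_single ⟨0, n.pos⟩]
    · simp
    · intro r _ hr
      rw [if_neg hr, mul_zero]
    · simp
  rw [← key A, h, key]

theorem ampliation_shift (n : ℕ+) (k : ℕ) : ampliation n (shift k) = shift ((n : ℕ) * k) :=
  clm_ext fun p => by
    obtain ⟨q, s, rfl⟩ := exists_residue n p
    rw [ampliation_apply, shift_e, sum_apply]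
    simp only [mul_apply_eq_comp, residue_star_e]
    rw [Finset.sum_eq_single s]
    · rw [if_pos rfl, shift_e, residue_e, mul_add, add_assoc]
    · intro r _ hr
      rw [if_neg hr, map_zero, map_zero]
    · simp

theorem ampliation_mem (n : ℕ+) {A : EllTwo ℕ →L[ℂ] EllTwo ℕ} (hA : A ∈ reducedSubalgebra ℕ) :
    ampliation n A ∈ reducedSubalgebra ℕ := by
  have hcont : Continuous (ampliation n) :=
    (NonUnitalStarAlgHom.isometry _ (ampliation_injective n)).continuous
  have hmap : StarSubalgebra.map (ampliation n) (reducedSubalgebra ℕ) ≤ reducedSubalgebra ℕ := by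
    refine (StarSubalgebra.map_topologicalClosure_le _ _ hcont).trans
      (StarSubalgebra.topologicalClosure_mono ?_)
    rw [StarAlgHom.map_adjoin]
    refine StarAlgebra.adjoin_le ?_
    rintro _ ⟨_, ⟨k, rfl⟩, rfl⟩
    rw [ampliation_shift]
    exact StarAlgebra.subset_adjoin ℂ _ ⟨_, rfl⟩
  exact hmap ⟨A, hA, rfl⟩

/-- The unital ⋆-endomorphism of the Toeplitz algebra with `T ↦ T ^ n`. -/
noncomputable def toeplitzHom (n : ℕ+) : ToeplitzAlg →⋆ₐ[ℂ] ToeplitzAlg where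
  toFun A := ⟨ampliation n (ReducedAlg.val ℕ A), ampliation_mem n (ReducedAlg.val_mem A)⟩
  map_one' := ReducedAlg.val_injective ℕ (map_one (ampliation n))
  map_mul' A _ := ReducedAlg.val_injective ℕ (map_mul (ampliation n) (ReducedAlg.val ℕ A) _)
  map_zero' := ReducedAlg.val_injective ℕ (map_zero (ampliation n))
  map_add' A _ := ReducedAlg.val_injective ℕ (map_add (ampliation n) (ReducedAlg.val ℕ A) _)
  commutes' c := ReducedAlg.val_injective ℕ ((ampliation n).commutes c)
  map_star' A := ReducedAlg.val_injective ℕ (map_star (ampliation n) (ReducedAlg.val ℕ A))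

theorem val_toeplitzHom (n : ℕ+) (A : ToeplitzAlg) :
    ReducedAlg.val ℕ (toeplitzHom n A) = ampliation n (ReducedAlg.val ℕ A) := rfl

theorem toeplitzHom_injective (n : ℕ+) : Function.Injective (toeplitzHom n) := fun A B h => by
  apply ReducedAlg.val_injective
  apply ampliation_injective n
  rw [← val_toeplitzHom, ← val_toeplitzHom, h]

theorem toeplitzHom_T (n : ℕ+) : toeplitzHom n toeplitzT = toeplitzT ^ (n : ℕ) := by
  apply ReducedAlg.val_injective
  rw [val_toeplitzHom, map_pow, toeplitzT, ReducedAlg.val_V, ampliation_shift, mul_one,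
    shift_eq_pow]

/-- A unital ⋆-homomorphism on the Toeplitz algebra is determined by its value at `T`. -/
theorem toeplitz_hom_ext {φ ψ : ToeplitzAlg →⋆ₐ[ℂ] ToeplitzAlg}
    (h : φ toeplitzT = ψ toeplitzT) : φ = ψ := by
  have hc : ∀ χ : ToeplitzAlg →⋆ₐ[ℂ] ToeplitzAlg, Continuous χ := fun χ =>
    AddMonoidHomClass.continuous_of_bound χ 1 fun x => by
      rw [one_mul]
      exact NonUnitalStarAlgHom.norm_apply_le χ x
  refine StarAlgHom.ext_topologicalClosure
    (S := StarAlgebra.adjoin ℂ (Set.range (shift : ℕ → EllTwo ℕ →L[ℂ] EllTwo ℕ)))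
    (hc φ) (hc ψ) (StarAlgHom.ext_adjoin fun x hx => ?_)
  obtain ⟨k, hk⟩ := hx
  have hx' : (StarSubalgebra.inclusion (StarSubalgebra.le_topologicalClosure _) x : ToeplitzAlg) =
      toeplitzT ^ k := ReducedAlg.val_injective ℕ <| by
    rw [map_pow, toeplitzT, ReducedAlg.val_V, ← shift_eq_pow]
    exact hk.symm
  refine (congrArg φ hx').trans (Eq.trans ?_ (congrArg ψ hx').symm)
  rw [map_pow, map_pow, h]

theorem toeplitzHom_unique {n : ℕ+} {φ : ToeplitzAlg →⋆ₐ[ℂ] ToeplitzAlg}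
    (h : φ toeplitzT = toeplitzT ^ (n : ℕ)) : φ = toeplitzHom n :=
  toeplitz_hom_ext (h.trans (toeplitzHom_T n).symm)

end Toeplitz

section Systems

/-- The inductive system of Toeplitz algebras over `K` defined by natural numbers `n b a`, for
`a ≤ b`, that satisfy the factorization equalities: every algebra is the Toeplitz algebra, and the
connecting morphism from `a` to `b` sends `T` to `T ^ n b a`. -/
noncomputable def toeplitzSystem {K : Type u} [PartialOrder K] (n : K → K → ℕ+)
    (hn : ∀ a b c, a ≤ b → b ≤ c → n c a = n c b * n b a) : CStarSystem.{u, 0} K where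
  obj _ := ToeplitzAlg
  map a b _ := toeplitzHom (n b a)
  map_injective a b _ := toeplitzHom_injective (n b a)
  map_self a x := by
    have h1 : n a a = 1 := by
      have h := hn a a a le_rfl le_rfl
      exact (mul_eq_left.1 h.symm)
    have h2 : StarAlgHom.id ℂ ToeplitzAlg = toeplitzHom (n a a) :=
      toeplitzHom_unique (by rw [h1, PNat.one_coe, pow_one]; rfl)
    rw [← h2]
    rfl
  map_map a b c hab hbc x := by
    have h : (toeplitzHom (n c b)).comp (toeplitzHom (n b a)) = toeplitzHom (n c a) :=
      toeplitzHom_unique (by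
        rw [StarAlgHom.comp_apply, toeplitzHom_T, map_pow, toeplitzHom_T, ← pow_mul,
          hn a b c hab hbc, PNat.mul_coe])
    rw [← h]
    rfl

/-- The maximal directed subsets of `K` (directed sets are non-empty). -/
def MaxDirected (K : Type u) [PartialOrder K] : Type u :=
  {S : Set K // Maximal (fun S : Set K => S.Nonempty ∧ DirectedOn (· ≤ ·) S) S}

instance MaxDirected.nonempty {K : Type u} [PartialOrder K] (i : MaxDirected K) :
    Nonempty i.1 := i.2.prop.1.to_subtype

instance MaxDirected.isDirectedOrder {K : Type u} [PartialOrder K] (i : MaxDirected K) :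
    IsDirectedOrder i.1 := ⟨directedOn_iff_directed.1 i.2.prop.2⟩

/-- The subgroup `ℚ_M = {m / (M 0 * ⋯ * M s)}` of `ℚ` given by a sequence `M` of natural
numbers. -/
def ratSubgroup (M : ℕ → ℕ+) : AddSubgroup ℚ where
  carrier := {q | ∃ (m : ℤ) (s : ℕ), q = m / ∏ j ∈ Finset.range (s + 1), (M j : ℚ)}
  zero_mem' := ⟨0, 0, by simp⟩
  neg_mem' := by
    rintro _ ⟨m, s, rfl⟩
    exact ⟨-m, s, by push_cast; ring⟩
  add_mem' := by
    have key : ∀ (m : ℤ) (s t : ℕ), s ≤ t → ∃ m' : ℤ,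
        (m : ℚ) / ∏ j ∈ Finset.range (s + 1), (M j : ℚ) =
          m' / ∏ j ∈ Finset.range (t + 1), (M j : ℚ) := by
      intro m s t hst
      induction t, hst using Nat.le_induction with
      | base => exact ⟨m, rfl⟩
      | succ t _ ih =>
        obtain ⟨m', hm'⟩ := ih
        refine ⟨m' * (M (t + 1) : ℕ), ?_⟩
        have hM : ((M (t + 1) : ℕ) : ℚ) ≠ 0 := by exact_mod_cast (M (t + 1)).ne_zero
        rw [hm', Finset.prod_range_succ _ (t + 1)]
        push_cast
        rw [mul_div_mul_right _ _ hM]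
    rintro _ _ ⟨m, s, rfl⟩ ⟨m', s', rfl⟩
    obtain ⟨k, hk⟩ := key m s (max s s') (le_max_left _ _)
    obtain ⟨k', hk'⟩ := key m' s' (max s s') (le_max_right _ _)
    exact ⟨k + k', max s s', by rw [hk, hk']; push_cast; ring⟩

/-- The positive cone `Γ⁺ = Γ ∩ [0, ∞)` of a subgroup `Γ` of `ℚ`. -/
def posCone (Γ : AddSubgroup ℚ) : AddSubmonoid ℚ where
  carrier := {q | q ∈ Γ ∧ 0 ≤ q}
  zero_mem' := ⟨Γ.zero_mem, le_rfl⟩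
  add_mem' ha hb := ⟨Γ.add_mem ha.1 hb.1, add_nonneg ha.2 hb.2⟩

/-- The direct product of C⋆-algebras: bounded families with the supremum norm. -/
abbrev CStarProd {I : Type u} (A : I → Type v) [∀ i, CStarAlgebra (A i)] : Type (max u v) :=
  lp A ∞

end Systems

/-!
The subsystem over each maximal directed set `D` is treated separately; the products are then
compared factor by factor (`CStarProd.congr`), and the maximal directed sets cover `K` by Zorn's
lemma (`MaxDirected.iUnion_eq_univ`).

Over a directed set `D` the factorization equalities say that `n b a = w a / w b` for positive
rational weights `w`, normalised so that `w` takes the value `1` (`exists_weight`). The cyclic groups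
`ℤ w a` then increase with `a`, and their union `Γ` is a subgroup of `ℚ` that contains `1`. Every
such subgroup is some `ℚ_M` (`exists_ratSubgroup_eq`): with `L s` the least common multiple of the
`m ≤ s` with `1 / m ∈ Γ`, one has `1 / L s ∈ Γ`, and `Γ` is the union of the groups `ℤ (1 / L s)`.

The limit is identified with `C⋆ᵣ(Γ⁺)` by sending the generator `T` at `a` to `V (w a)`. Such a
⋆-homomorphism exists and is faithful because division with remainder by `x = w a` splits `Γ⁺` into
copies `r + ℕ x`, `0 ≤ r < x`, of `ℕ` on which translation by `x` is the successor. Accordingly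
`ℓ²(Γ⁺)` is a direct sum of copies of `ℓ²(ℕ)`, and the ampliation `A ↦ ⨁ r, A` (`EllTwo.diag`) is an
injective unital ⋆-homomorphism of the algebras of all bounded operators that sends `T` to `V x`
(`exists_toeplitz_hom_posCone`). These homomorphisms are compatible with the connecting maps since
`V (w a) = V (w b) ^ n b a`, and their ranges generate `C⋆ᵣ(Γ⁺)` since every element of `Γ⁺` is a
multiple of some `w a`. So `C⋆ᵣ(Γ⁺)` is the limit (`CStarSystem.Limit.nonempty_starAlgEquiv`).
-/

/-! ### Ampliation along a decomposition of `P` into copies of `ℕ` -/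

namespace EllTwo

theorem hasSum_norm_sq {P : Type u} (f : EllTwo P) : HasSum (fun p => ‖f p‖ ^ 2) (‖f‖ ^ 2) := by
  simpa [Real.rpow_two] using lp.hasSum_norm (p := 2) (by norm_num) f

theorem memlp_two {P : Type u} {f : P → ℂ} (hf : Summable fun p => ‖f p‖ ^ 2) : Memℓp f 2 :=
  memℓp_gen (by simpa [Real.rpow_two] using hf)

variable {R : Type u} {P : Type v} (s : R × ℕ ≃ P)

theorem injective_fiberMap (r : R) : Function.Injective fun k => s (r, k) :=
  s.injective.comp (Prod.mk_right_injective r)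

/-- The restriction of `f ∈ ℓ²(P)` to the `r`-th copy of `ℕ` under `R × ℕ ≃ P`, as an element of
`ℓ²(ℕ)`. It is encoded as the adjoint of the inclusion of `ℓ²(ℕ)` as the `r`-th summand. -/
noncomputable def fiber (r : R) : EllTwo P →L[ℂ] EllTwo ℕ :=
  (basisMap (fun k => s (r, k)) (injective_fiberMap s r)).adjoint

theorem fiber_apply (r : R) (f : EllTwo P) (k : ℕ) : fiber s r f k = f (s (r, k)) := by
  rw [← inner_e_left, fiber, ContinuousLinearMap.adjoint_inner_right, basisMap_e, inner_e_left]

theorem fiber_e [DecidableEq R] (r t : R) (k : ℕ) :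
    fiber s r (e (s (t, k))) = if t = r then e k else 0 := by
  ext l
  rw [fiber_apply]
  split_ifs with h
  · subst h
    simp [e_apply]
  · rw [e_apply, if_neg fun h' => h (congrArg Prod.fst (s.injective h'))]
    rfl

theorem hasSum_norm_sq_fiber (f : EllTwo P) : HasSum (fun r => ‖fiber s r f‖ ^ 2) (‖f‖ ^ 2) := by
  refine HasSum.prod_fiberwise (f := fun x => ‖f (s x)‖ ^ 2)
    (s.hasSum_iff.2 (hasSum_norm_sq f)) fun r => ?_
  simpa only [fiber_apply] using hasSum_norm_sq (fiber s r f)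

/-- A square summable family of vectors of `ℓ²(ℕ)` assembles to a vector of `ℓ²(P)`. -/
theorem hasSum_glue {g : R → EllTwo ℕ} {C : ℝ} (hg : HasSum (fun r => ‖g r‖ ^ 2) C) :
    HasSum (fun p => ‖g (s.symm p).1 (s.symm p).2‖ ^ 2) C := by
  rw [← s.hasSum_iff]
  have h1 : ∀ r, HasSum (fun k => ‖g r k‖ ^ 2) (‖g r‖ ^ 2) := fun r => hasSum_norm_sq (g r)
  have h2 : Summable fun x : R × ℕ => ‖g x.1 x.2‖ ^ 2 := by
    refine (summable_prod_of_nonneg fun x => by positivity).2 ⟨fun r => (h1 r).summable, ?_⟩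
    simpa only [(h1 _).tsum_eq] using hg.summable
  have h3 : HasSum (fun x : R × ℕ => ‖g x.1 x.2‖ ^ 2) C := by
    have h4 := h2.hasSum.prod_fiberwise h1
    rw [hg.unique h4]
    exact h2.hasSum
  simpa [Function.comp_def] using h3

theorem summable_norm_sq_apply_fiber (A : EllTwo ℕ →L[ℂ] EllTwo ℕ) (f : EllTwo P) :
    Summable fun r => ‖A (fiber s r f)‖ ^ 2 := by
  refine Summable.of_nonneg_of_le (fun r => by positivity) (fun r => ?_)
    ((hasSum_norm_sq_fiber s f).summable.mul_left (‖A‖ ^ 2))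
  rw [← mul_pow]
  gcongr
  exact A.le_opNorm _

/-- The vector with restriction `A f_r` to the `r`-th copy of `ℕ`, where `f_r` is the restriction
of `f`. -/
noncomputable def diagFun (A : EllTwo ℕ →L[ℂ] EllTwo ℕ) (f : EllTwo P) : EllTwo P :=
  ⟨fun p => A (fiber s (s.symm p).1 f) (s.symm p).2,
    memlp_two (hasSum_glue s (summable_norm_sq_apply_fiber s A f).hasSum).summable⟩

theorem diagFun_apply (A : EllTwo ℕ →L[ℂ] EllTwo ℕ) (f : EllTwo P) (p : P) :
    diagFun s A f p = A (fiber s (s.symm p).1 f) (s.symm p).2 := rfl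

theorem norm_diagFun_le (A : EllTwo ℕ →L[ℂ] EllTwo ℕ) (f : EllTwo P) :
    ‖diagFun s A f‖ ≤ ‖A‖ * ‖f‖ := by
  have hA := summable_norm_sq_apply_fiber s A f
  have hf := hasSum_norm_sq_fiber s f
  have h0 := hasSum_glue s hA.hasSum
  simp only [← diagFun_apply] at h0
  have h1 := (hasSum_norm_sq (diagFun s A f)).unique h0
  refine (sq_le_sq₀ (norm_nonneg _) (by positivity)).1 ?_
  rw [mul_pow, h1, ← hf.tsum_eq, ← tsum_mul_left]
  refine hA.tsum_le_tsum (fun r => ?_) (hf.summable.mul_left _)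
  rw [← mul_pow]
  exact pow_le_pow_left₀ (norm_nonneg _) (A.le_opNorm _) 2

/-- The operator `⨁ r, A` on `ℓ²(P) = ⨁ r, ℓ²(ℕ)`. -/
noncomputable def diagOp (A : EllTwo ℕ →L[ℂ] EllTwo ℕ) : EllTwo P →L[ℂ] EllTwo P :=
  LinearMap.mkContinuous
    { toFun := diagFun s A
      map_add' := fun f g => lp.ext <| funext fun p => by
        rw [lp.coeFn_add, Pi.add_apply]
        simp only [diagFun_apply, map_add, lp.coeFn_add, Pi.add_apply]
      map_smul' := fun c f => lp.ext <| funext fun p => by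
        rw [RingHom.id_apply, lp.coeFn_smul, Pi.smul_apply]
        simp only [diagFun_apply, map_smul, lp.coeFn_smul, Pi.smul_apply] }
    ‖A‖ (norm_diagFun_le s A)

theorem diagOp_apply (A : EllTwo ℕ →L[ℂ] EllTwo ℕ) (f : EllTwo P) (r : R) (k : ℕ) :
    diagOp s A f (s (r, k)) = A (fiber s r f) k := by
  change A (fiber s (s.symm (s (r, k))).1 f) (s.symm (s (r, k))).2 = _
  rw [s.symm_apply_apply]

theorem fiber_diagOp (A : EllTwo ℕ →L[ℂ] EllTwo ℕ) (f : EllTwo P) (r : R) :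
    fiber s r (diagOp s A f) = A (fiber s r f) := by
  ext k
  rw [fiber_apply, diagOp_apply]

/-- Vectors of `ℓ²(P)` agree if their restrictions to all copies of `ℕ` agree. -/
theorem ext_fiber {f g : EllTwo P} (h : ∀ r, fiber s r f = fiber s r g) : f = g := by
  ext p
  obtain ⟨⟨r, k⟩, rfl⟩ := s.surjective p
  rw [← fiber_apply, h, fiber_apply]

theorem inner_diagOp_left [DecidableEq R] (A : EllTwo ℕ →L[ℂ] EllTwo ℕ) (r t : R) (k l : ℕ) :
    inner ℂ (e (s (r, k))) (diagOp s A (e (s (t, l)))) =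
      if t = r then inner ℂ (e k) (A (e l)) else 0 := by
  rw [inner_e_left, diagOp_apply, fiber_e]
  split_ifs
  · rw [inner_e_left]
  · rw [map_zero]; rfl

theorem diagOp_star (A : EllTwo ℕ →L[ℂ] EllTwo ℕ) : diagOp s (star A) = star (diagOp s A) := by
  classical
  refine clm_ext fun q => ext_e fun p => ?_
  obtain ⟨⟨r, k⟩, rfl⟩ := s.surjective p
  obtain ⟨⟨t, l⟩, rfl⟩ := s.surjective q
  rw [ContinuousLinearMap.star_eq_adjoint, ContinuousLinearMap.star_eq_adjoint,
    ContinuousLinearMap.adjoint_inner_right, inner_diagOp_left,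
    ContinuousLinearMap.adjoint_inner_right, ← inner_conj_symm (diagOp s A _), inner_diagOp_left]
  by_cases h : t = r
  · simp [h]
  · simp [h, Ne.symm h]

/-- The ampliation `A ↦ ⨁ r, A` as a unital ⋆-homomorphism. -/
noncomputable def diag : (EllTwo ℕ →L[ℂ] EllTwo ℕ) →⋆ₐ[ℂ] (EllTwo P →L[ℂ] EllTwo P) where
  toFun := diagOp s
  map_one' := ContinuousLinearMap.ext fun f => ext_fiber s fun r => by
    rw [fiber_diagOp]; rfl
  map_mul' A B := ContinuousLinearMap.ext fun f => ext_fiber s fun r => by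
    rw [mul_apply_eq_comp, fiber_diagOp, fiber_diagOp, fiber_diagOp, mul_apply_eq_comp]
  map_zero' := ContinuousLinearMap.ext fun f => ext_fiber s fun r => by
    rw [fiber_diagOp, zero_apply, zero_apply, map_zero]
  map_add' A B := ContinuousLinearMap.ext fun f => ext_fiber s fun r => by
    rw [fiber_diagOp, add_apply, add_apply, map_add, fiber_diagOp, fiber_diagOp]
  commutes' c := ContinuousLinearMap.ext fun f => ext_fiber s fun r => by
    rw [fiber_diagOp, Algebra.algebraMap_eq_smul_one, Algebra.algebraMap_eq_smul_one,
      smul_apply, smul_apply, map_smul]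
    rfl
  map_star' := diagOp_star s

theorem fiber_diag (A : EllTwo ℕ →L[ℂ] EllTwo ℕ) (f : EllTwo P) (r : R) :
    fiber s r (diag s A f) = A (fiber s r f) := fiber_diagOp s A f r

theorem diag_injective [Nonempty R] : Function.Injective (diag s) := by
  classical
  intro A B h
  obtain ⟨r⟩ := ‹Nonempty R›
  refine clm_ext fun k => ?_
  have h' := congrArg (fun C => fiber s r (C (e (s (r, k))))) h
  simpa [fiber_diag, fiber_e] using h'

/-- If translation by `w` acts on `P ≃ R × ℕ` as the successor on the second factor, then the
ampliation sends the unilateral shift to the isometry `V w`. -/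
theorem diag_shift_one [AddMonoid P] [IsLeftCancelAdd P] {w : P}
    (hs : ∀ r k, s (r, k + 1) = w + s (r, k)) : diag s (shift 1) = shift w := by
  classical
  refine clm_ext fun p => ext_fiber s fun r => ?_
  obtain ⟨⟨t, k⟩, rfl⟩ := s.surjective p
  rw [fiber_diag, shift_e, ← hs, fiber_e, fiber_e]
  split_ifs
  · rw [shift_e, add_comm]
  · rw [map_zero]

end EllTwo

/-! ### Faithful representations of the Toeplitz algebra in `C⋆ᵣ(P)` -/

section ToeplitzToReduced

open EllTwo

variable {P : Type v} [AddMonoid P] [IsLeftCancelAdd P]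

theorem reducedAlg_hom_continuous {B : Type w} [CStarAlgebra B] (χ : ReducedAlg P →⋆ₐ[ℂ] B) :
    Continuous χ :=
  AddMonoidHomClass.continuous_of_bound χ 1 fun x => by
    rw [one_mul]
    exact NonUnitalStarAlgHom.norm_apply_le χ x

/-- Two unital ⋆-homomorphisms from the Toeplitz algebra into any unital C⋆-algebra agree as soon
as they agree at the generator `T`. -/
theorem toeplitzAlg_hom_ext {B : Type w} [CStarAlgebra B] {φ ψ : ToeplitzAlg →⋆ₐ[ℂ] B}
    (h : φ toeplitzT = ψ toeplitzT) : φ = ψ := by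
  refine StarAlgHom.ext_topologicalClosure
    (S := StarAlgebra.adjoin ℂ (Set.range (shift : ℕ → EllTwo ℕ →L[ℂ] EllTwo ℕ)))
    (reducedAlg_hom_continuous φ) (reducedAlg_hom_continuous ψ)
    (StarAlgHom.ext_adjoin fun x hx => ?_)
  obtain ⟨k, hk⟩ := hx
  have hx' : (StarSubalgebra.inclusion (StarSubalgebra.le_topologicalClosure _) x : ToeplitzAlg) =
      toeplitzT ^ k := ReducedAlg.val_injective ℕ <| by
    rw [map_pow, toeplitzT, ReducedAlg.val_V, ← shift_eq_pow]
    exact hk.symm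
  refine (congrArg φ hx').trans (Eq.trans ?_ (congrArg ψ hx').symm)
  rw [map_pow, map_pow, h]

theorem ReducedAlg.V_nsmul (g : P) (k : ℕ) : ReducedAlg.V (k • g) = ReducedAlg.V g ^ k := by
  apply ReducedAlg.val_injective
  rw [map_pow, ReducedAlg.val_V, ReducedAlg.val_V]
  induction k with
  | zero => rw [zero_smul, shift_zero, pow_zero]
  | succ k ih => rw [succ_nsmul, shift_add, ih, pow_succ]

variable {R : Type u} (s : R × ℕ ≃ P) {w : P} (hs : ∀ r k, s (r, k + 1) = w + s (r, k))
include hs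

theorem diag_mem_reducedSubalgebra [Nonempty R] {A : EllTwo ℕ →L[ℂ] EllTwo ℕ}
    (hA : A ∈ reducedSubalgebra ℕ) : diag s A ∈ reducedSubalgebra P := by
  have hcont : Continuous (diag s) :=
    (NonUnitalStarAlgHom.isometry _ (diag_injective s)).continuous
  have hmap : StarSubalgebra.map (diag s) (reducedSubalgebra ℕ) ≤ reducedSubalgebra P := by
    refine (StarSubalgebra.map_topologicalClosure_le _ _ hcont).trans
      (StarSubalgebra.topologicalClosure_mono ?_)
    rw [StarAlgHom.map_adjoin]
    refine StarAlgebra.adjoin_le ?_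
    rintro _ ⟨_, ⟨k, rfl⟩, rfl⟩
    rw [shift_eq_pow, map_pow, diag_shift_one s hs]
    exact pow_mem (StarAlgebra.subset_adjoin ℂ _ (Set.mem_range_self w)) k
  exact hmap ⟨A, hA, rfl⟩

/-- If `P` is a disjoint union of copies of `ℕ` on which translation by `w` acts as the successor,
then there is an injective unital ⋆-homomorphism from the Toeplitz algebra to `C⋆ᵣ(P)` that sends
`T` to `V w`. -/
theorem exists_toeplitz_hom [Nonempty R] :
    ∃ φ : ToeplitzAlg →⋆ₐ[ℂ] ReducedAlg P, Function.Injective φ ∧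
      φ toeplitzT = ReducedAlg.V w := by
  let φ : ToeplitzAlg →⋆ₐ[ℂ] ReducedAlg P :=
    { toFun := fun A => (⟨diag s (ReducedAlg.val ℕ A),
        diag_mem_reducedSubalgebra s hs (ReducedAlg.val_mem A)⟩ : reducedSubalgebra P)
      map_one' := ReducedAlg.val_injective P (map_one (diag s))
      map_mul' := fun A _ => ReducedAlg.val_injective P (map_mul (diag s) (ReducedAlg.val ℕ A) _)
      map_zero' := ReducedAlg.val_injective P (map_zero (diag s))
      map_add' := fun A _ => ReducedAlg.val_injective P (map_add (diag s) (ReducedAlg.val ℕ A) _)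
      commutes' := fun c => ReducedAlg.val_injective P ((diag s).commutes c)
      map_star' := fun A => ReducedAlg.val_injective P (map_star (diag s) (ReducedAlg.val ℕ A)) }
  refine ⟨φ, fun A B h => ?_, ReducedAlg.val_injective P (diag_shift_one s hs)⟩
  exact ReducedAlg.val_injective ℕ (diag_injective s (congrArg (ReducedAlg.val P) h))

end ToeplitzToReduced

/-! ### Recognizing an inductive limit -/

/-- A subset of a C⋆-algebra generates it if its image under a faithful representation does. -/
theorem topologicalClosure_adjoin_eq_top {B : Type u} {C : Type v} [CStarAlgebra B]
    [CStarAlgebra C] {ι : B →⋆ₐ[ℂ] C} (hι : Function.Injective ι) {G : Set B}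
    (hG : ∀ y, ι y ∈ (StarAlgebra.adjoin ℂ (ι '' G)).topologicalClosure) :
    (StarAlgebra.adjoin ℂ G).topologicalClosure = ⊤ := by
  set T := (StarAlgebra.adjoin ℂ G).topologicalClosure
  have hiso : Isometry ι := NonUnitalStarAlgHom.isometry ι hι
  have hclosed : IsClosed (T.map ι : Set C) :=
    hiso.isClosedEmbedding.isClosedMap _ (StarSubalgebra.isClosed_topologicalClosure _)
  have hle : (StarAlgebra.adjoin ℂ (ι '' G)).topologicalClosure ≤ T.map ι := by
    refine StarSubalgebra.topologicalClosure_minimal (StarAlgebra.adjoin_le ?_) hclosed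
    rintro _ ⟨g, hg, rfl⟩
    exact ⟨g, StarSubalgebra.le_topologicalClosure _ (StarAlgebra.subset_adjoin ℂ _ hg), rfl⟩
  refine eq_top_iff.2 fun y _ => ?_
  obtain ⟨x, hx, hxy⟩ := hle (hG y)
  exact hι hxy ▸ hx

namespace CStarSystem.Limit

open UniformSpace

section lift

variable {K : Type u} [PartialOrder K] [IsDirectedOrder K] [Nonempty K] (F : CStarSystem.{u, v} K)
  {B : Type w} [CStarAlgebra B] (φ : ∀ a, F.obj a →⋆ₐ[ℂ] B)
  (hφ : ∀ a b (h : a ≤ b) x, φ b (F.map a b h x) = φ a x)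

/-- The map from the algebraic direct limit induced by a compatible family of morphisms. -/
noncomputable def algLift : F.AlgLimit → B :=
  DirectLimit.lift F.map (fun a x => φ a x) fun a b h x => (hφ a b h x).symm

/-- The map from the inductive limit induced by a compatible family of morphisms, as the extension
by continuity of `algLift`. It is meaningful once `algLift` is known to be uniformly continuous,
which holds for injective morphisms (`isometry_algLift`). -/
noncomputable def liftFun : F.Limit → B :=
  Completion.extension (algLift F φ hφ)

variable (hinj : ∀ a, Function.Injective (φ a))
include hinj

theorem isometry_algLift : Isometry (algLift F φ hφ) := by
  refine Isometry.of_dist_eq <| DirectLimit.induction₂ _ fun a x y => ?_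
  rw [dist_eq_norm, dist_eq_norm, sub_eq_add_neg (⟦⟨a, x⟩⟧ : F.AlgLimit), DirectLimit.neg_def,
    DirectLimit.add_def, algLimit_norm_mk, ← sub_eq_add_neg]
  change ‖φ a x - φ a y‖ = _
  rw [← map_sub]
  exact NonUnitalStarAlgHom.norm_map _ (hinj a) _

theorem isometry_liftFun : Isometry (liftFun F φ hφ) :=
  (isometry_algLift F φ hφ hinj).completion_extension

theorem liftFun_coe (x : F.AlgLimit) : liftFun F φ hφ (coe F x) = algLift F φ hφ x :=
  Completion.extension_coe (isometry_algLift F φ hφ hinj).uniformContinuous x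

theorem liftFun_of (a : K) (x : F.obj a) : liftFun F φ hφ (of F a x) = φ a x :=
  liftFun_coe F φ hφ hinj _

/-- The unital ⋆-homomorphism from the inductive limit induced by a compatible family of injective
morphisms. -/
noncomputable def lift : F.Limit →⋆ₐ[ℂ] B where
  toFun := liftFun F φ hφ
  map_one' := by
    obtain ⟨a⟩ := ‹Nonempty K›
    rw [← map_one (of F a), liftFun_of F φ hφ hinj, map_one]
  map_zero' := by
    obtain ⟨a⟩ := ‹Nonempty K›
    rw [← map_zero (of F a), liftFun_of F φ hφ hinj, map_zero]
  map_mul' x y := by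
    have hc := (isometry_liftFun F φ hφ hinj).continuous
    refine (denseRange_coe F).induction_on₂
      (p := fun x y => liftFun F φ hφ (x * y) = liftFun F φ hφ x * liftFun F φ hφ y)
      (isClosed_eq (hc.comp continuous_mul)
        ((hc.comp continuous_fst).mul (hc.comp continuous_snd))) ?_ x y
    refine DirectLimit.induction₂ _ fun a x y => ?_
    change liftFun F φ hφ (of F a x * of F a y) =
      liftFun F φ hφ (of F a x) * liftFun F φ hφ (of F a y)
    rw [← map_mul, liftFun_of F φ hφ hinj, liftFun_of F φ hφ hinj, liftFun_of F φ hφ hinj, map_mul]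
  map_add' x y := by
    have hc := (isometry_liftFun F φ hφ hinj).continuous
    refine (denseRange_coe F).induction_on₂
      (p := fun x y => liftFun F φ hφ (x + y) = liftFun F φ hφ x + liftFun F φ hφ y)
      (isClosed_eq (hc.comp continuous_add)
        ((hc.comp continuous_fst).add (hc.comp continuous_snd))) ?_ x y
    refine DirectLimit.induction₂ _ fun a x y => ?_
    change liftFun F φ hφ (of F a x + of F a y) =
      liftFun F φ hφ (of F a x) + liftFun F φ hφ (of F a y)
    rw [← map_add, liftFun_of F φ hφ hinj, liftFun_of F φ hφ hinj, liftFun_of F φ hφ hinj, map_add]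
  commutes' c := by
    obtain ⟨a⟩ := ‹Nonempty K›
    rw [← (of F a).commutes c]
    exact (liftFun_of F φ hφ hinj a _).trans ((φ a).commutes c)
  map_star' x := by
    have hc := (isometry_liftFun F φ hφ hinj).continuous
    refine (denseRange_coe F).induction_on
      (p := fun x => liftFun F φ hφ (star x) = star (liftFun F φ hφ x)) x
      (isClosed_eq (hc.comp (continuous_star' F)) hc.star) ?_
    refine DirectLimit.induction _ fun a x => ?_
    change liftFun F φ hφ (star (of F a x)) = star (liftFun F φ hφ (of F a x))
    rw [← map_star, liftFun_of F φ hφ hinj, liftFun_of F φ hφ hinj, map_star]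

include hφ in
/-- A C⋆-algebra that contains compatible copies of the algebras of a system, and is generated by
them, is the inductive limit of the system. -/
theorem nonempty_starAlgEquiv
    (hgen : (StarAlgebra.adjoin ℂ (⋃ a, Set.range (φ a))).topologicalClosure = ⊤) :
    Nonempty (F.Limit ≃⋆ₐ[ℂ] B) := by
  have hiso := isometry_liftFun F φ hφ hinj
  refine ⟨StarAlgEquiv.ofBijective (lift F φ hφ hinj) ⟨hiso.injective, fun y => ?_⟩⟩
  have hclosed : IsClosed ((lift F φ hφ hinj).range : Set B) :=
    hiso.isClosedEmbedding.isClosed_range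
  have hle : (StarAlgebra.adjoin ℂ (⋃ a, Set.range (φ a))).topologicalClosure ≤
      (lift F φ hφ hinj).range := by
    refine StarSubalgebra.topologicalClosure_minimal (StarAlgebra.adjoin_le ?_) hclosed
    refine Set.iUnion_subset fun a => ?_
    rintro _ ⟨x, rfl⟩
    exact ⟨of F a x, liftFun_of F φ hφ hinj a x⟩
  rw [hgen] at hle
  exact hle (StarSubalgebra.mem_top (x := y))

end lift

end CStarSystem.Limit

/-! ### Subgroups of `ℚ` and their positive cones -/

section Rational

/-- A Bézout relation between numerator and denominator of `q` writes `1 / q.den` as an integral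
combination of `q` and `1`. -/
theorem AddSubgroup.inv_den_mem {Γ : AddSubgroup ℚ} (h1 : (1 : ℚ) ∈ Γ) {q : ℚ} (hq : q ∈ Γ) :
    ((q.den : ℚ))⁻¹ ∈ Γ := by
  obtain ⟨x, y, hxy⟩ := (Int.isCoprime_iff_gcd_eq_one.2 q.reduced : IsCoprime q.num (q.den : ℤ))
  have hd : (q.den : ℚ) ≠ 0 := by exact_mod_cast q.den_ne_zero
  have key : ((q.den : ℚ))⁻¹ = x • q + y • (1 : ℚ) := by
    have h : (x : ℚ) * q.num + y * q.den = 1 := by exact_mod_cast hxy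
    rw [zsmul_eq_mul, zsmul_eq_mul]
    nth_rewrite 2 [← Rat.num_div_den q]
    field_simp
    linear_combination -h
  rw [key]
  exact Γ.add_mem (Γ.zsmul_mem hq x) (Γ.zsmul_mem h1 y)

/-- A Bézout relation between `a` and `b` writes `1 / lcm a b` as an integral combination of `1 / b`
and `1 / a`. -/
theorem AddSubgroup.inv_lcm_mem {Γ : AddSubgroup ℚ} {a b : ℕ} (ha : a ≠ 0) (hb : b ≠ 0)
    (haΓ : (a : ℚ)⁻¹ ∈ Γ) (hbΓ : (b : ℚ)⁻¹ ∈ Γ) : ((Nat.lcm a b : ℕ) : ℚ)⁻¹ ∈ Γ := by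
  have hl : ((Nat.lcm a b : ℕ) : ℚ) ≠ 0 := by exact_mod_cast Nat.lcm_ne_zero ha hb
  have ha' : (a : ℚ) ≠ 0 := by exact_mod_cast ha
  have hb' : (b : ℚ) ≠ 0 := by exact_mod_cast hb
  have hgl : ((Nat.gcd a b : ℕ) : ℚ) * (Nat.lcm a b : ℕ) = a * b := by
    exact_mod_cast Nat.gcd_mul_lcm a b
  have hbez : ((Nat.gcd a b : ℕ) : ℚ) = a * (Nat.gcdA a b : ℤ) + b * (Nat.gcdB a b : ℤ) := by
    exact_mod_cast Nat.gcd_eq_gcd_ab a b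
  have key : ((Nat.lcm a b : ℕ) : ℚ)⁻¹ = Nat.gcdA a b • (b : ℚ)⁻¹ + Nat.gcdB a b • (a : ℚ)⁻¹ := by
    rw [zsmul_eq_mul, zsmul_eq_mul]
    field_simp
    linear_combination -hgl + (Nat.lcm a b : ℚ) * hbez
  rw [key]
  exact Γ.add_mem (Γ.zsmul_mem hbΓ _) (Γ.zsmul_mem haΓ _)

open scoped Classical in
/-- The least common multiple of those `m ≤ s` with `1 / m ∈ Γ`. -/
noncomputable def denLcm (Γ : AddSubgroup ℚ) : ℕ → ℕ
  | 0 => 1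
  | s + 1 => if ((s + 1 : ℕ) : ℚ)⁻¹ ∈ Γ then Nat.lcm (denLcm Γ s) (s + 1) else denLcm Γ s

theorem denLcm_ne_zero (Γ : AddSubgroup ℚ) (s : ℕ) : denLcm Γ s ≠ 0 := by
  induction s with
  | zero => simp [denLcm]
  | succ s ih =>
    rw [denLcm]
    split_ifs
    · exact Nat.lcm_ne_zero ih s.succ_ne_zero
    · exact ih

theorem inv_denLcm_mem {Γ : AddSubgroup ℚ} (h1 : (1 : ℚ) ∈ Γ) (s : ℕ) :
    ((denLcm Γ s : ℕ) : ℚ)⁻¹ ∈ Γ := by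
  induction s with
  | zero => simpa [denLcm] using h1
  | succ s ih =>
    rw [denLcm]
    split_ifs with h
    · exact AddSubgroup.inv_lcm_mem (denLcm_ne_zero Γ s) s.succ_ne_zero ih h
    · exact ih

theorem denLcm_dvd_succ (Γ : AddSubgroup ℚ) (s : ℕ) : denLcm Γ s ∣ denLcm Γ (s + 1) := by
  rw [denLcm]
  split_ifs
  · exact Nat.dvd_lcm_left _ _
  · exact dvd_rfl

theorem dvd_denLcm {Γ : AddSubgroup ℚ} {s : ℕ} (h : ((s + 1 : ℕ) : ℚ)⁻¹ ∈ Γ) :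
    s + 1 ∣ denLcm Γ (s + 1) := by
  rw [denLcm, if_pos h]
  exact Nat.dvd_lcm_right _ _

/-- Every subgroup of `ℚ` that contains `1` is of the form `ℚ_M`: the partial products of `M` can be
taken to be the numbers `denLcm`. -/
theorem exists_ratSubgroup_eq {Γ : AddSubgroup ℚ} (h1 : (1 : ℚ) ∈ Γ) :
    ∃ M : ℕ → ℕ+, ratSubgroup M = Γ := by
  choose c hc using denLcm_dvd_succ Γ
  have hc0 : ∀ s, 0 < c s := fun s =>
    Nat.pos_of_ne_zero fun h => denLcm_ne_zero Γ (s + 1) (by rw [hc, h, mul_zero])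
  let M : ℕ → ℕ+ := fun s => ⟨c s, hc0 s⟩
  have hM : ∀ s, ∏ j ∈ Finset.range s, (M j : ℚ) = denLcm Γ s := by
    intro s
    induction s with
    | zero => simp [denLcm]
    | succ s ih =>
      rw [Finset.prod_range_succ, ih, hc]
      push_cast
      rfl
  refine ⟨M, AddSubgroup.ext fun q => ⟨?_, fun hq => ?_⟩⟩
  · rintro ⟨m, s, rfl⟩
    rw [hM, div_eq_mul_inv, ← zsmul_eq_mul]
    exact Γ.zsmul_mem (inv_denLcm_mem h1 _) m
  · obtain ⟨s, hs⟩ := Nat.exists_eq_succ_of_ne_zero q.den_ne_zero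
    have hmem := AddSubgroup.inv_den_mem h1 hq
    rw [hs] at hmem
    obtain ⟨d, hd⟩ := dvd_denLcm hmem
    have hd0 : (d : ℚ) ≠ 0 := by
      intro h
      rw [Nat.cast_eq_zero] at h
      exact denLcm_ne_zero Γ (s + 1) (by rw [hd, h, mul_zero])
    refine ⟨q.num * d, s, ?_⟩
    rw [hM, hd]
    push_cast
    rw [mul_div_mul_right _ _ hd0]
    conv_lhs => rw [← Rat.num_div_den q, hs]
    push_cast
    rfl

variable {Γ : AddSubgroup ℚ} (x : posCone Γ)

/-- Division with remainder by `x > 0` in the positive cone of a subgroup of `ℚ`. -/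
theorem bijective_divMod (hx : 0 < (x : ℚ)) :
    Function.Bijective fun p : {r : posCone Γ // (r : ℚ) < x} × ℕ => p.2 • x + p.1.1 := by
  constructor
  · rintro ⟨⟨r, hr⟩, k⟩ ⟨⟨t, ht⟩, l⟩ h
    have h' : (k : ℚ) * x + r = l * x + t := by
      simpa using congrArg Subtype.val h
    have hr0 : (0 : ℚ) ≤ r := r.2.2
    have ht0 : (0 : ℚ) ≤ t := t.2.2
    have hkl : k = l := by
      rcases lt_trichotomy k l with h1 | h1 | h1
      · have h2 : (k : ℚ) + 1 ≤ l := by exact_mod_cast h1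
        nlinarith
      · exact h1
      · have h2 : (l : ℚ) + 1 ≤ k := by exact_mod_cast h1
        nlinarith
    subst hkl
    have hrt : r = t := Subtype.ext (add_left_cancel h')
    subst hrt
    rfl
  · intro p
    have hp0 : (0 : ℚ) ≤ p := p.2.2
    set k := ⌊(p : ℚ) / x⌋₊
    have hk1 : (k : ℚ) * x ≤ p := (le_div_iff₀ hx).1 (Nat.floor_le (by positivity))
    have hk2 : (p : ℚ) < (k + 1) * x := (div_lt_iff₀ hx).1 (Nat.lt_floor_add_one _)
    refine ⟨⟨⟨⟨p - k * x, ?_, sub_nonneg.2 hk1⟩, ?_⟩, k⟩, Subtype.ext ?_⟩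
    · rw [← nsmul_eq_mul]
      exact Γ.sub_mem p.2.1 (Γ.nsmul_mem x.2.1 k)
    · change (p : ℚ) - k * x < x
      linarith
    · simp

/-- For every `x > 0` in the positive cone `Γ⁺` there is a faithful unital ⋆-homomorphism from the
Toeplitz algebra to `C⋆ᵣ(Γ⁺)` that sends `T` to `V x`. -/
theorem exists_toeplitz_hom_posCone (hx : 0 < (x : ℚ)) :
    ∃ φ : ToeplitzAlg →⋆ₐ[ℂ] ReducedAlg (posCone Γ), Function.Injective φ ∧
      φ toeplitzT = ReducedAlg.V x := by
  have : Nonempty {r : posCone Γ // (r : ℚ) < x} := ⟨⟨0, hx⟩⟩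
  refine exists_toeplitz_hom (Equiv.ofBijective _ (bijective_divMod x hx)) fun r k => ?_
  change (k + 1) • x + r.1 = x + (k • x + r.1)
  rw [succ_nsmul', add_assoc]

end Rational

/-! ### Inductive limits of Toeplitz algebras over directed sets -/

section Weights

variable {D : Type u} [PartialOrder D] [IsDirectedOrder D] {n : D → D → ℕ+}

/-- The connecting numbers of a directed system are the ratios of positive rational weights, which
can be normalised to take the value `1`. -/
theorem exists_weight [Nonempty D] (hn : ∀ a b c, a ≤ b → b ≤ c → n c a = n c b * n b a) :
    ∃ w : D → ℚ, (∀ a, 0 < w a) ∧ (∀ a b, a ≤ b → w a = n b a * w b) ∧ ∃ a, w a = 1 := by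
  obtain ⟨o⟩ := ‹Nonempty D›
  choose c hca hco using fun a => exists_ge_ge a o
  have hpos : ∀ a b, (0 : ℚ) < n a b := fun a b => by exact_mod_cast (n a b).pos
  -- The weight of `a` is `n d a / n d o` for any upper bound `d` of `a` and of the base point `o`.
  have key : ∀ a d, a ≤ d → o ≤ d → (n (c a) a : ℚ) / n (c a) o = n d a / n d o := by
    have step : ∀ a d f, a ≤ d → o ≤ d → d ≤ f →
        (n d a : ℚ) / n d o = n f a / n f o := by
      intro a d f had hod hdf
      have h1 : (n f a : ℚ) = n f d * n d a := by exact_mod_cast congrArg PNat.val (hn a d f had hdf)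
      have h2 : (n f o : ℚ) = n f d * n d o := by exact_mod_cast congrArg PNat.val (hn o d f hod hdf)
      rw [h1, h2, mul_div_mul_left _ _ (hpos f d).ne']
    intro a d had hod
    obtain ⟨f, hcf, hdf⟩ := exists_ge_ge (c a) d
    rw [step a (c a) f (hca a) (hco a) hcf, step a d f had hod hdf]
  refine ⟨fun a => n (c a) a / n (c a) o, fun a => div_pos (hpos _ _) (hpos _ _), ?_, o, ?_⟩
  · intro a b hab
    have h1 : (n (c b) a : ℚ) = n (c b) b * n b a := by
      exact_mod_cast congrArg PNat.val (hn a b (c b) hab (hca b))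
    simp only
    rw [key a (c b) (hab.trans (hca b)) (hco b), h1]
    ring
  · exact div_self (hpos _ _).ne'

/-- The increasing union `⋃ a, ℤ w a` of cyclic subgroups of `ℚ`. -/
def weightSubgroup [Nonempty D] (w : D → ℚ) (hw : ∀ a b, a ≤ b → w a = n b a * w b) :
    AddSubgroup ℚ where
  carrier := {q | ∃ (a : D) (k : ℤ), q = k * w a}
  zero_mem' := ⟨Classical.arbitrary D, 0, by simp⟩
  neg_mem' := by
    rintro _ ⟨a, k, rfl⟩
    exact ⟨a, -k, by push_cast; ring⟩
  add_mem' := by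
    rintro _ _ ⟨a, k, rfl⟩ ⟨b, l, rfl⟩
    obtain ⟨c, hac, hbc⟩ := exists_ge_ge a b
    refine ⟨c, k * (n c a : ℕ) + l * (n c b : ℕ), ?_⟩
    rw [hw a c hac, hw b c hbc]
    push_cast
    ring

/-- The inductive limit of a system of Toeplitz algebras over a directed set is the reduced
semigroup C⋆-algebra of the positive cone of some `ℚ_M`. -/
theorem exists_limit_equiv [Nonempty D]
    (hn : ∀ a b c, a ≤ b → b ≤ c → n c a = n c b * n b a) :
    ∃ M : ℕ → ℕ+,
      Nonempty ((toeplitzSystem n hn).Limit ≃⋆ₐ[ℂ] ReducedAlg (posCone (ratSubgroup M))) := by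
  obtain ⟨w, hpos, hw, o, ho⟩ := exists_weight hn
  obtain ⟨M, hM⟩ := exists_ratSubgroup_eq (Γ := weightSubgroup w hw) ⟨o, 1, by simp [ho]⟩
  refine ⟨M, ?_⟩
  rw [hM]
  let x : D → posCone (weightSubgroup w hw) := fun a => ⟨w a, ⟨a, 1, by simp⟩, (hpos a).le⟩
  choose φ hinj hφ using fun a => exists_toeplitz_hom_posCone (x a) (hpos a)
  refine CStarSystem.Limit.nonempty_starAlgEquiv (toeplitzSystem n hn) φ (fun a b hab A => ?_) hinj
    (topologicalClosure_adjoin_eq_top (ReducedAlg.val_injective _) fun y => ?_)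
  · have h : (φ b).comp (toeplitzHom (n b a)) = φ a := toeplitzAlg_hom_ext (by
      rw [StarAlgHom.comp_apply, toeplitzHom_T, map_pow, hφ, hφ, ← ReducedAlg.V_nsmul]
      refine congrArg ReducedAlg.V (Subtype.ext ?_)
      simpa [x] using (hw a b hab).symm)
    exact DFunLike.congr_fun h A
  · refine StarSubalgebra.topologicalClosure_mono (StarAlgebra.adjoin_mono ?_)
      (ReducedAlg.val_mem y)
    -- Every `g ≥ 0` in the group is a multiple `k • w a`, so `V g` is the image of `T ^ k`.
    rintro _ ⟨⟨_, ⟨a, k, rfl⟩, hk⟩, rfl⟩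
    have hk0 : 0 ≤ k := by
      have hk' : (0 : ℚ) ≤ k := nonneg_of_mul_nonneg_left hk (hpos a)
      exact_mod_cast hk'
    lift k to ℕ using hk0
    refine ⟨φ a (toeplitzT ^ k), Set.mem_iUnion.2 ⟨a, _, rfl⟩, ?_⟩
    rw [map_pow, hφ, ← ReducedAlg.V_nsmul, ReducedAlg.val_V]
    refine congrArg shift (Subtype.ext ?_)
    simp [x]

end Weights

/-! ### Products and maximal directed subsets -/

/-- Isomorphisms of the factors give an isomorphism of the direct products; it preserves
boundedness because isomorphisms of C⋆-algebras are isometric. -/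
noncomputable def CStarProd.congr {I : Type u} {A : I → Type v} {B : I → Type w}
    [∀ i, CStarAlgebra (A i)] [∀ i, CStarAlgebra (B i)] (f : ∀ i, A i ≃⋆ₐ[ℂ] B i) :
    CStarProd A ≃⋆ₐ[ℂ] CStarProd B where
  toFun x := ⟨fun i => f i (x i), memℓp_infty (by
    simpa only [StarAlgEquiv.norm_map] using (lp.memℓp x).bddAbove)⟩
  invFun y := ⟨fun i => (f i).symm (y i), memℓp_infty (by
    simpa only [StarAlgEquiv.norm_map] using (lp.memℓp y).bddAbove)⟩
  left_inv x := lp.ext (funext fun i => (f i).symm_apply_apply (x i))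
  right_inv y := lp.ext (funext fun i => (f i).apply_symm_apply (y i))
  map_mul' x y := lp.ext (funext fun i => map_mul (f i) (x i) (y i))
  map_add' x y := lp.ext (funext fun i => map_add (f i) (x i) (y i))
  map_star' x := lp.ext (funext fun i => map_star (f i) (x i))
  map_smul' c x := lp.ext (funext fun i => map_smul (f i) c (x i))

/-- Singletons are directed and unions of chains of directed sets are directed, so every point lies
in a maximal directed set. -/
theorem MaxDirected.iUnion_eq_univ {K : Type u} [PartialOrder K] :
    (⋃ i : MaxDirected K, i.1) = Set.univ := by
  refine Set.eq_univ_of_forall fun a => ?_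
  obtain ⟨S, haS, hS⟩ := zorn_subset_nonempty
    {S : Set K | S.Nonempty ∧ DirectedOn (· ≤ ·) S} (fun c hc hchain hne => by
      refine ⟨⋃₀ c, ⟨?_, Set.directedOn_sUnion hchain.directedOn fun s hs => (hc hs).2⟩,
        fun s hs => Set.subset_sUnion_of_mem hs⟩
      obtain ⟨s, hs⟩ := hne
      exact (hc hs).1.mono (Set.subset_sUnion_of_mem hs)) {a}
    ⟨Set.singleton_nonempty a, directedOn_singleton _⟩
  exact Set.mem_iUnion.2 ⟨⟨S, hS⟩, haS rfl⟩

theorem mainTheorem2 {K : Type*} [PartialOrder K] (n : K → K → ℕ+)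
    (hn : ∀ a b c, a ≤ b → b ≤ c → n c a = n c b * n b a) :
    (⋃ i : MaxDirected K, i.1) = Set.univ ∧
    ∃ M : MaxDirected K → ℕ → ℕ+,
      Nonempty (CStarProd (fun i : MaxDirected K => ((toeplitzSystem n hn).restrict i.1).Limit)
        ≃⋆ₐ[ℂ] CStarProd (fun i : MaxDirected K => ReducedAlg (posCone (ratSubgroup (M i))))) := by
  refine ⟨MaxDirected.iUnion_eq_univ, ?_⟩
  choose M hM using fun i : MaxDirected K =>
    exists_limit_equiv (D := i.1) (n := fun a b => n a b)
      fun a b c hab hbc => hn a b c hab hbc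
  exact ⟨M, ⟨CStarProd.congr fun i => (hM i).some⟩⟩
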